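/- Let $F$ be the free group on a set $\mathbf x$ and let $\mathcal P=(\mathbf x,\mathbf r)$, $\mathbf r\subseteq F$, be a group presentation. Let $Y$ be the set of formal symbols ${}^u r$ ($u\in F$, $r\in\mathbf r$), and let $Y\cup Y^{-1}$ be the set of symbols $({}^u r)^{\varepsilon}$, $\varepsilon=\pm1$; put $\theta(({}^u r)^{\varepsilon})=ur^{\varepsilon}u^{-1}$ and ${}^{w}(({}^{u}r)^{\varepsilon})=({}^{wu}r)^{\varepsilon}$ for $w\in F$. Finite sequences over $Y\cup Y^{-1}$ are called $Y$-sequences; such a sequence is an identity $Y$-sequence if the product of the values of $\theta$ on its terms is $1$. Peiffer equivalence of $Y$-sequences is the equivalence relation generated by the exchanges of an adjacent pair $(a,b)$ for $({}^{\theta(a)}b,a)$ or for $(b,{}^{\theta(b)^{-1}}a)$ and by the deletions of adjacent pairs $(a,a^{-1})$. The presentation $\mathcal P$ is aspherical if every identity $Y$-sequence is Peiffer equivalent to the empty sequence. Let $\Upsilon$ be the monoid generated by $Y\cup Y^{-1}$ subject to the relations $ab=({}^{\theta(a)}b)\,a$ for $a,b\in Y\cup Y^{-1}$, let $\sigma$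 be the canonical map from $Y$-sequences to $\Upsilon$, let $\mu:\Upsilon\to\mathcal G(\Upsilon)$ be the universal enveloping group of $\Upsilon$, and let $\tilde\theta:\mathcal G(\Upsilon)\to F$ be the homomorphism $\mu\sigma(({}^u r)^{\varepsilon})\mapsto ur^{\varepsilon}u^{-1}$. The action of $F$ on symbols induces an action on $\mathcal G(\Upsilon)$. Let $\sim_{\mathfrak U}$ be the equivalence relation on $\Upsilon$ generated by the pairs $(s,\,s\,\sigma(a)\sigma(a^{-1}))$, $s\in\Upsilon$, $a\in Y\cup Y^{-1}$. Let $r_0\in\mathbf r$, let $\mathcal P_1=(\mathbf x,\mathbf r_1)$ with $\mathbf r_1=\mathbf r\setminus\{r_0\}$, and let $N_0$ be the normal closure of $r_0$ in $F$. Objects formed from $\mathcal P_1$ carry the index $1$. Let $\tilde\Pi_1=\operatorname{Ker}\tilde\theta_1$, which is a central subgroup of $\mathcal G(\Upsilon_1)$ stable under $F$; let $[\tilde\Pi_1,N_0]$ be the subgroup of $\tilde\Pi_1$ generated by the elements ${}^{n}d\,d^{-1}$ with $d\in\tilde\Pi_1$, $n\in N_0$; let $\hat{\mathfrak A}_1$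 be the subgroup of $\mathcal G(\Upsilon)$ generated by the elements $\mu\sigma(bb^{-1})$ with $b\in Y_1\cup Y_1^{-1}$; and let $\hat f:\mathcal G(\Upsilon_1)\to\mathcal G(\Upsilon)$ be the homomorphism induced by the inclusion $Y_1\subseteq Y$. **Theorem.** Suppose that $\mathcal P$ is aspherical. Then $\hat f$ induces a homomorphism $\hat\varphi:\tilde\Pi_1/[\tilde\Pi_1,N_0]\to\hat{\mathfrak A}_1$, and $\mathcal P_1$ is aspherical if and only if both of the following hold: (1) for every identity $Y_1$-sequence $d=(a_1,\dots,a_n)$ and every $n_0\in N_0$, the sequence ${}^{n_0}d\,d^{-1}=({}^{n_0}a_1,\dots,{}^{n_0}a_n,a_n^{-1},\dots,a_1^{-1})$ satisfies $\sigma_1({}^{n_0}d\,d^{-1})\sim_{\mathfrak U_1}1$; (2) $\hat\varphi$ is an isomorphism. -/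

import Mathlib

namespace Peiffer

universe u

/-! ### Universal enveloping group of a monoid presentation -/

section Enveloping

variable {A : Type u}

/-- The canonical homomorphism from the free monoid to the free group on `A`. -/
def wordToFreeGroup : FreeMonoid A →* FreeGroup A := FreeMonoid.lift FreeGroup.of

/-- The group relators `u * v⁻¹`, one for each defining pair `(u, v)` of a monoid presentation. -/
def envelopingRels (rels : FreeMonoid A → FreeMonoid A → Prop) : Set (FreeGroup A) :=
  {w | ∃ p q, rels p q ∧ w = wordToFreeGroup p * (wordToFreeGroup q)⁻¹}

/-- The universal enveloping group of the monoid presented by `rels`. -/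
abbrev EnvelopingGroup (rels : FreeMonoid A → FreeMonoid A → Prop) : Type u :=
  PresentedGroup (envelopingRels rels)

theorem lift_comp_wordToFreeGroup {G : Type*} [Group G] (g : A → G) (w : FreeMonoid A) :
    FreeGroup.lift g (wordToFreeGroup w) = FreeMonoid.lift g w := by
  have : (FreeGroup.lift g).comp wordToFreeGroup = FreeMonoid.lift g := by
    ext a; simp [wordToFreeGroup]
  exact DFunLike.congr_fun this w

theorem lift_of_eq_mk {M : Type*} [Monoid M] {rels : FreeMonoid A → FreeMonoid A → Prop}
    (g : PresentedMonoid rels →* M) (w : FreeMonoid A) :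
    FreeMonoid.lift (fun a => g (PresentedMonoid.of rels a)) w = g (PresentedMonoid.mk rels w) := by
  have : FreeMonoid.lift (fun a => g (PresentedMonoid.of rels a))
      = g.comp (PresentedMonoid.mk rels) := by
    ext a; simp [PresentedMonoid.of]
  exact DFunLike.congr_fun this w

/-- The canonical map `μ` from a presented monoid to its universal enveloping group. -/
def toEnveloping (rels : FreeMonoid A → FreeMonoid A → Prop) :
    PresentedMonoid rels →* EnvelopingGroup rels :=
  PresentedMonoid.lift (fun a => PresentedGroup.of a) (by
    intro p q h
    have key : ∀ w : FreeMonoid A, FreeMonoid.lift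
        (fun a => (PresentedGroup.of a : EnvelopingGroup rels)) w
        = PresentedGroup.mk (envelopingRels rels) (wordToFreeGroup w) := by
      intro w
      have : FreeMonoid.lift (fun a => (PresentedGroup.of a : EnvelopingGroup rels))
          = (PresentedGroup.mk (envelopingRels rels)).comp wordToFreeGroup := by
        ext a; simp [wordToFreeGroup, PresentedGroup.of]
      exact DFunLike.congr_fun this w
    change FreeMonoid.lift _ p = FreeMonoid.lift _ q
    rw [key, key, ← mul_inv_eq_one, ← map_inv, ← map_mul]
    exact PresentedGroup.one_of_mem ⟨p, q, h, rfl⟩)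

/-- The universal property of `μ`: a monoid homomorphism `g` into a group extends uniquely to the
universal enveloping group. -/
def envelopingLift {G : Type*} [Group G] {rels : FreeMonoid A → FreeMonoid A → Prop}
    (g : PresentedMonoid rels →* G) : EnvelopingGroup rels →* G :=
  PresentedGroup.toGroup (f := fun a => g (PresentedMonoid.of rels a)) (by
    rintro w ⟨p, q, h, rfl⟩
    rw [map_mul, map_inv, lift_comp_wordToFreeGroup, lift_comp_wordToFreeGroup, lift_of_eq_mk,
      lift_of_eq_mk, PresentedMonoid.mk_eq_mk_of_rel h, mul_inv_cancel])

theorem envelopingLift_comp_toEnveloping {G : Type*} [Group G]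
    {rels : FreeMonoid A → FreeMonoid A → Prop} (g : PresentedMonoid rels →* G) :
    (envelopingLift g).comp (toEnveloping rels) = g := by
  apply PresentedMonoid.ext
  intro a
  simp [envelopingLift, toEnveloping]

theorem enveloping_hom_ext {G : Type*} [Group G]
    {rels : FreeMonoid A → FreeMonoid A → Prop} {g h : EnvelopingGroup rels →* G}
    (H : ∀ a, g (toEnveloping rels (PresentedMonoid.of rels a))
      = h (toEnveloping rels (PresentedMonoid.of rels a))) : g = h := by
  apply PresentedGroup.ext
  intro a
  simpa [toEnveloping] using H a

end Enveloping

/-! ### `Y`-sequences, Peiffer operations, asphericity -/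

variable {X : Type u}

/-- The symbols `(ᵘr)^ε` with `u` in the free group `F` on `X`, `r` a relator and `ε = ± 1`, that
is, the elements of `Y ∪ Y⁻¹`. -/
@[ext]
structure YSymbol (R : Set (FreeGroup X)) where
  conj : FreeGroup X
  rel : R
  sign : ℤˣ

namespace YSymbol

variable {R : Set (FreeGroup X)}

/-- The formal inverse `(ᵘr)^(-ε)` of `(ᵘr)^ε`. -/
def inv (a : YSymbol R) : YSymbol R := ⟨a.conj, a.rel, -a.sign⟩

/-- `θ((ᵘr)^ε) = u r^ε u⁻¹`. -/
def theta (a : YSymbol R) : FreeGroup X :=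
  a.conj * (a.rel : FreeGroup X) ^ (a.sign : ℤ) * a.conj⁻¹

/-- The action `ʷ((ᵘr)^ε) = (ʷᵘr)^ε` of `F`. -/
instance : MulAction (FreeGroup X) (YSymbol R) where
  smul w a := ⟨w * a.conj, a.rel, a.sign⟩
  one_smul a := by
    change (⟨1 * a.conj, a.rel, a.sign⟩ : YSymbol R) = a
    rw [one_mul]
  mul_smul v w a := by
    change (⟨v * w * a.conj, a.rel, a.sign⟩ : YSymbol R) = ⟨v * (w * a.conj), a.rel, a.sign⟩
    rw [mul_assoc]

theorem smul_def (w : FreeGroup X) (a : YSymbol R) : w • a = ⟨w * a.conj, a.rel, a.sign⟩ := rfl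

theorem theta_smul (w : FreeGroup X) (a : YSymbol R) : (w • a).theta = w * a.theta * w⁻¹ := by
  simp [smul_def, theta, mul_assoc]

/-- The inclusion of symbols induced by an inclusion of sets of relators. -/
def incl {R S : Set (FreeGroup X)} (h : R ⊆ S) (a : YSymbol R) : YSymbol S :=
  ⟨a.conj, Set.inclusion h a.rel, a.sign⟩

end YSymbol

/-- `Y`-sequences, with concatenation as product. -/
abbrev YSeq (R : Set (FreeGroup X)) : Type u := FreeMonoid (YSymbol R)

namespace YSeq

variable {R : Set (FreeGroup X)}

/-- `∏ uᵢ rᵢ^εᵢ uᵢ⁻¹` in `F`. -/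
def theta : YSeq R →* FreeGroup X := FreeMonoid.lift YSymbol.theta

/-- Identity `Y`-sequences. -/
def IsIdentity (d : YSeq R) : Prop := theta d = 1

/-- The action of `w ∈ F`, symbol by symbol. -/
def act (w : FreeGroup X) : YSeq R →* YSeq R := FreeMonoid.map (fun a => w • a)

/-- The formal inverse: `(a₁, …, aₙ)` becomes `(aₙ⁻¹, …, a₁⁻¹)`. -/
def inv (d : YSeq R) : YSeq R := FreeMonoid.reverse (FreeMonoid.map YSymbol.inv d)

end YSeq

open FreeMonoid in
/-- Elementary Peiffer exchanges and Peiffer deletions. -/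
inductive PeifferStep {R : Set (FreeGroup X)} : YSeq R → YSeq R → Prop
  | exchangeLeft (p q : YSeq R) (a b : YSymbol R) :
      PeifferStep (p * (of a * of b) * q) (p * (of (a.theta • b) * of a) * q)
  | exchangeRight (p q : YSeq R) (a b : YSymbol R) :
      PeifferStep (p * (of a * of b) * q) (p * (of b * of (b.theta⁻¹ • a)) * q)
  | deletion (p q : YSeq R) (a : YSymbol R) :
      PeifferStep (p * (of a * of a.inv) * q) (p * q)

/-- Peiffer equivalence of `Y`-sequences (insertions are the inverses of deletions). -/
def PeifferEquiv {R : Set (FreeGroup X)} : YSeq R → YSeq R → Prop :=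
  Relation.EqvGen PeifferStep

/-- The presentation `(X, R)` is aspherical: every identity `Y`-sequence is Peiffer equivalent to
the empty sequence. -/
def IsAspherical (R : Set (FreeGroup X)) : Prop :=
  ∀ d : YSeq R, d.IsIdentity → PeifferEquiv d 1

/-! ### The monoid `Υ` and its group `𝒢(Υ)` -/

section Upsilon

variable (R : Set (FreeGroup X))

/-- The defining pairs `(ab, (^{θ(a)}b) a)` of `Υ`, with `a, b ∈ Y ∪ Y⁻¹`. -/
def upsilonRels : YSeq R → YSeq R → Prop := fun p q =>
  ∃ a b : YSymbol R, p = FreeMonoid.of a * FreeMonoid.of b ∧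
    q = FreeMonoid.of (a.theta • b) * FreeMonoid.of a

/-- The monoid `Υ`. -/
abbrev Upsilon : Type u := PresentedMonoid (upsilonRels R)

/-- The group `𝒢(Υ)`. -/
abbrev GUpsilon : Type u := EnvelopingGroup (upsilonRels R)

/-- The canonical map `σ` from `Y`-sequences to `Υ`. -/
def sigma : YSeq R →* Upsilon R := PresentedMonoid.mk (upsilonRels R)

/-- The canonical map `μ` from `Υ` to `𝒢(Υ)`. -/
def mu : Upsilon R →* GUpsilon R := toEnveloping (upsilonRels R)

variable {R}

theorem of_mul_of (a b : YSymbol R) :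
    PresentedMonoid.of (upsilonRels R) a * PresentedMonoid.of (upsilonRels R) b
      = PresentedMonoid.of (upsilonRels R) (a.theta • b) * PresentedMonoid.of (upsilonRels R) a :=
  PresentedMonoid.mk_eq_mk_of_rel (rels := upsilonRels R)
    (x := FreeMonoid.of a * FreeMonoid.of b)
    (y := FreeMonoid.of (a.theta • b) * FreeMonoid.of a) ⟨a, b, rfl, rfl⟩

/-- Two elements of `Υ` are Peiffer equivalent if they are related by the equivalence relation
generated by the pairs `(σ(α), σ(α) σ(a) σ(a⁻¹))`. -/
def UpsilonPeifferEquiv : Upsilon R → Upsilon R → Prop :=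
  Relation.EqvGen fun s t => ∃ (p : YSeq R) (a : YSymbol R), s = sigma R p ∧
    t = sigma R p * (sigma R (FreeMonoid.of a) * sigma R (FreeMonoid.of a.inv))

/-- Homomorphisms out of `Υ`. -/
def upsilonLift {M : Type*} [Monoid M] (g : YSymbol R → M)
    (hg : ∀ a b : YSymbol R, g a * g b = g (a.theta • b) * g a) : Upsilon R →* M :=
  PresentedMonoid.lift g (by
    rintro p q ⟨a, b, rfl, rfl⟩
    simpa using hg a b)

@[simp]
theorem upsilonLift_of {M : Type*} [Monoid M] (g : YSymbol R → M)
    (hg : ∀ a b : YSymbol R, g a * g b = g (a.theta • b) * g a) (a : YSymbol R) :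
    upsilonLift g hg (PresentedMonoid.of _ a) = g a := rfl

/-- Homomorphisms out of `𝒢(Υ)`. -/
def gUpsilonLift {G : Type*} [Group G] (g : YSymbol R → G)
    (hg : ∀ a b : YSymbol R, g a * g b = g (a.theta • b) * g a) : GUpsilon R →* G :=
  envelopingLift (upsilonLift g hg)

/-- The image of a symbol in `𝒢(Υ)`. -/
def gen (a : YSymbol R) : GUpsilon R := mu R (sigma R (FreeMonoid.of a))

@[simp]
theorem gUpsilonLift_gen {G : Type*} [Group G] (g : YSymbol R → G)
    (hg : ∀ a b : YSymbol R, g a * g b = g (a.theta • b) * g a) (a : YSymbol R) :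
    gUpsilonLift g hg (gen a) = g a :=
  DFunLike.congr_fun (envelopingLift_comp_toEnveloping (upsilonLift g hg))
    (PresentedMonoid.of _ a)

theorem gUpsilon_hom_ext {G : Type*} [Group G] {g h : GUpsilon R →* G}
    (H : ∀ a, g (gen a) = h (gen a)) : g = h :=
  enveloping_hom_ext H

theorem gen_mul_gen (a b : YSymbol R) : gen a * gen b = gen (a.theta • b) * gen a := by
  have := congrArg (mu R) (of_mul_of a b)
  rwa [map_mul, map_mul] at this

/-- The homomorphism `θ̃ : 𝒢(Υ) → F` with `(ᵘr)^ε ↦ u r^ε u⁻¹`. -/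
def thetaTilde : GUpsilon R →* FreeGroup X :=
  gUpsilonLift YSymbol.theta (by intro a b; rw [YSymbol.theta_smul]; group)

/-- The endomorphism of `𝒢(Υ)` by which `w ∈ F` acts, with `(ᵘr)^ε ↦ (ʷᵘr)^ε`. -/
def actHom (w : FreeGroup X) : GUpsilon R →* GUpsilon R :=
  gUpsilonLift (fun a => gen (w • a)) (by
    intro a b
    rw [gen_mul_gen, YSymbol.theta_smul, smul_smul, smul_smul]
    simp)

/-- The action of `F` on `𝒢(Υ)`. -/
instance : MulDistribMulAction (FreeGroup X) (GUpsilon R) where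
  smul w g := actHom w g
  one_smul g := by
    have : actHom (1 : FreeGroup X) = MonoidHom.id (GUpsilon R) :=
      gUpsilon_hom_ext fun a => by simp [actHom]
    exact DFunLike.congr_fun this g
  mul_smul v w g := by
    have : actHom (v * w) = (actHom v).comp (actHom (R := R) w) :=
      gUpsilon_hom_ext fun a => by simp [actHom, mul_smul]
    exact DFunLike.congr_fun this g
  smul_one w := map_one (actHom w)
  smul_mul w := map_mul (actHom w)

theorem smul_gen (w : FreeGroup X) (a : YSymbol R) : w • gen a = gen (w • a) :=
  gUpsilonLift_gen _ _ a

theorem thetaTilde_gen (a : YSymbol R) : thetaTilde (gen a) = a.theta :=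
  gUpsilonLift_gen _ _ a

theorem thetaTilde_smul (w : FreeGroup X) (g : GUpsilon R) :
    thetaTilde (w • g) = w * thetaTilde g * w⁻¹ := by
  have : thetaTilde.comp (actHom w)
      = (MulAut.conj w).toMonoidHom.comp (thetaTilde (R := R)) :=
    gUpsilon_hom_ext fun a => by
      simp only [MonoidHom.comp_apply]
      change thetaTilde (w • gen a) = _
      rw [smul_gen, thetaTilde_gen, thetaTilde_gen, YSymbol.theta_smul]
      simp
  exact DFunLike.congr_fun this g

/-- The Peiffer identity in `𝒢(Υ)`. -/
theorem conj_eq_smul (g h : GUpsilon R) : g * h * g⁻¹ = thetaTilde g • h := by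
  have : (MulAut.conj : GUpsilon R →* MulAut (GUpsilon R))
      = (MulDistribMulAction.toMulAut (FreeGroup X) (GUpsilon R)).comp thetaTilde :=
    gUpsilon_hom_ext fun a => by
      apply MulEquiv.toMonoidHom_injective
      apply gUpsilon_hom_ext
      intro b
      change gen a * gen b * (gen a)⁻¹ = thetaTilde (gen a) • gen b
      rw [thetaTilde_gen, smul_gen, gen_mul_gen, mul_inv_cancel_right]
  exact DFunLike.congr_fun (DFunLike.congr_fun this g) h

variable (R)

/-- The generalized module of identities `Π̃`, the kernel of `θ̃`. -/
def PiTilde : Subgroup (GUpsilon R) := (thetaTilde (R := R)).ker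

variable {R}

theorem piTilde_central {g : GUpsilon R} (hg : g ∈ PiTilde R) (h : GUpsilon R) :
    g * h = h * g := by
  have := conj_eq_smul g h
  rw [MonoidHom.mem_ker.1 hg, one_smul] at this
  exact mul_inv_eq_iff_eq_mul.1 this

variable (R)

/-- The displacement subgroup `[Π̃, N]`, generated in `Π̃` by the elements `ⁿd d⁻¹` with `d ∈ Π̃`
and `n ∈ N`. -/
def displacement (N : Subgroup (FreeGroup X)) : Subgroup (PiTilde R) :=
  Subgroup.closure {x | ∃ d : PiTilde R, ∃ n ∈ N,
    (x : GUpsilon R) = (n • (d : GUpsilon R)) * (d : GUpsilon R)⁻¹}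

instance (N : Subgroup (FreeGroup X)) : (displacement R N).Normal where
  conj_mem x hx g := by
    have : g * x = x * g := Subtype.ext (piTilde_central g.2 x)
    rwa [this, mul_inv_cancel_right]

end Upsilon

/-! ### Subpresentations -/

section Sub

variable {R S : Set (FreeGroup X)}

/-- The homomorphism `f̂ : 𝒢(Υ₁) → 𝒢(Υ)` induced by an inclusion of sets of relators. -/
def fHat (h : R ⊆ S) : GUpsilon R →* GUpsilon S :=
  gUpsilonLift (fun a => gen (a.incl h)) fun a b => gen_mul_gen (a.incl h) (b.incl h)

/-- The subgroup `𝔄̂₁` of `𝒢(Υ)` generated by the elements `μσ(b b⁻¹)` with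
`b ∈ Y₁ ∪ Y₁⁻¹`. -/
def AHat (h : R ⊆ S) : Subgroup (GUpsilon S) :=
  Subgroup.closure {x | ∃ b : YSymbol R,
    x = mu S (sigma S (FreeMonoid.of (b.incl h) * FreeMonoid.of (b.incl h).inv))}

end Sub

end Peiffer

open Peiffer

/-!
Peiffer classes of `Y`-sequences form the group `𝒢(Υ) ⧸ 𝔄̂`, where `𝔄̂` is the subgroup
generated by the elements `a a⁻¹`. It is contained in the central subgroup `Π̃`, so asphericity
of `𝒫` says `Π̃ = 𝔄̂`, and condition (1) of the theorem says that `[Π̃₁, N₀]` is contained in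
the analogue of `𝔄̂` for `𝒫₁`, which `f̂` maps onto `𝔄̂₁`.

Two homomorphisms control `f̂`. Sending a positive symbol `a` to `a a⁻¹` and a negative one to
`1` gives a retraction `ρ` of `𝒢(Υ)` onto `𝔄̂`, equivariant and natural in the set of relators.
By naturality, `f̂` maps `Π̃₁` into `𝔄̂₁` as soon as `Π̃ = 𝔄̂`. Secondly, killing the symbols of
the removed relators gives a homomorphism from `𝒢(Υ)` to the quotient of `𝒢(Υ₁)` by the elements
`ⁿg g⁻¹` with `n ∈ N₀`, so these elements generate a normal subgroup that contains `Ker f̂`; and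
`ρ` carries that subgroup into `[Π̃₁, N₀]`. An element of `Ker f̂` that is fixed by `ρ`
therefore lies in `[Π̃₁, N₀]`, which gives the injectivity of `φ̂` when `𝒫₁` is aspherical.
-/

namespace Peiffer

section SmulCommutator

variable {F : Type*} (G : Type*) [Group F] [Group G] [MulDistribMulAction F G] (N : Subgroup F)

/-- The normal subgroup `[G, N]` generated by the elements `ⁿg g⁻¹`: it is the smallest one modulo
which `N` acts trivially. -/
def smulCommutator : Subgroup G :=
  Subgroup.normalClosure {x | ∃ g : G, ∃ n ∈ N, n • g * g⁻¹ = x}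

instance : (smulCommutator G N).Normal := Subgroup.normalClosure_normal

variable {G N}

theorem mk_smul_smulCommutator {n : F} (hn : n ∈ N) (g : G) :
    (QuotientGroup.mk (n • g) : G ⧸ smulCommutator G N) = QuotientGroup.mk g := by
  rw [← mul_inv_eq_one, ← QuotientGroup.mk_inv, ← QuotientGroup.mk_mul, QuotientGroup.eq_one_iff]
  exact Subgroup.subset_normalClosure ⟨g, n, hn, rfl⟩

end SmulCommutator

theorem eqvGen_map {α β : Type*} {r : α → α → Prop} {s : β → β → Prop} {f : α → β}
    (hf : ∀ x y, r x y → Relation.EqvGen s (f x) (f y)) {x y : α} (h : Relation.EqvGen r x y) :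
    Relation.EqvGen s (f x) (f y) :=
  ((Relation.EqvGen.is_equivalence s).comap f).eqvGen_iff.1 (Relation.EqvGen.mono hf _ _ h)

variable {X : Type*} {R S : Set (FreeGroup X)}

namespace YSymbol

@[simp]
theorem inv_inv (a : YSymbol R) : a.inv.inv = a := by
  ext <;> simp [inv]

@[simp]
theorem theta_inv (a : YSymbol R) : a.inv.theta = a.theta⁻¹ := by
  simp [inv, theta, mul_assoc]

theorem theta_mem {N : Subgroup (FreeGroup X)} [N.Normal] {a : YSymbol R}
    (ha : (a.rel : FreeGroup X) ∈ N) : a.theta ∈ N :=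
  Subgroup.Normal.conj_mem ‹_› _ (zpow_mem ha _) _

end YSymbol

/-! ### Cancelling pairs and the module of identities -/

theorem thetaTilde_smul_of_mem_piTilde (g : GUpsilon R) {d : GUpsilon R} (hd : d ∈ PiTilde R) :
    thetaTilde g • d = d := by
  rw [← conj_eq_smul, ← piTilde_central hd g, mul_inv_cancel_right]

theorem normalClosure_le_range_thetaTilde :
    Subgroup.normalClosure R ≤ (thetaTilde (R := R)).range := by
  have : (thetaTilde (R := R)).range.Normal := ⟨by
    rintro _ ⟨g, rfl⟩ w
    exact ⟨w • g, thetaTilde_smul w g⟩⟩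
  refine Subgroup.normalClosure_le_normal fun r hr => ⟨gen ⟨1, ⟨r, hr⟩, 1⟩, ?_⟩
  simp [thetaTilde_gen, YSymbol.theta]

theorem smul_eq_self_of_mem_normalClosure {n : FreeGroup X} (hn : n ∈ Subgroup.normalClosure R)
    {d : GUpsilon R} (hd : d ∈ PiTilde R) : n • d = d := by
  obtain ⟨g, rfl⟩ := normalClosure_le_range_thetaTilde hn
  exact thetaTilde_smul_of_mem_piTilde g hd

theorem smul_mem_piTilde (w : FreeGroup X) {d : GUpsilon R} (hd : d ∈ PiTilde R) :
    w • d ∈ PiTilde R := by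
  rw [PiTilde, MonoidHom.mem_ker] at hd ⊢
  rw [thetaTilde_smul, hd, mul_one, mul_inv_cancel]

/-- The element `a a⁻¹` of `𝒢(Υ)`, which need not be trivial because `a⁻¹` is a formal inverse. -/
def cancelPair (a : YSymbol R) : GUpsilon R := gen a * gen a.inv

theorem cancelPair_mem_piTilde (a : YSymbol R) : cancelPair a ∈ PiTilde R := by
  simp [PiTilde, MonoidHom.mem_ker, cancelPair, thetaTilde_gen]

theorem smul_cancelPair (w : FreeGroup X) (a : YSymbol R) :
    w • cancelPair a = cancelPair (w • a) := by
  rw [cancelPair, smul_mul', smul_gen, smul_gen]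
  rfl

theorem cancelPair_theta_smul (a b : YSymbol R) : cancelPair (a.theta • b) = cancelPair b := by
  rw [← smul_cancelPair, ← thetaTilde_gen,
    thetaTilde_smul_of_mem_piTilde _ (cancelPair_mem_piTilde b)]

theorem cancelPair_inv (a : YSymbol R) : cancelPair a.inv = cancelPair a := by
  have hcomm : cancelPair a * gen a = gen a * cancelPair a :=
    piTilde_central (cancelPair_mem_piTilde a) (gen a)
  rw [cancelPair, mul_assoc] at hcomm
  rw [cancelPair, YSymbol.inv_inv]
  exact mul_left_cancel hcomm

/-- The subgroup `𝔄̂` of `𝒢(Υ)` generated by the elements `a a⁻¹` with `a ∈ Y ∪ Y⁻¹`; the quotient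
by it turns formal inverses into inverses. -/
def cancelSubgroup (R : Set (FreeGroup X)) : Subgroup (GUpsilon R) :=
  Subgroup.closure (Set.range cancelPair)

theorem cancelPair_mem_cancelSubgroup (a : YSymbol R) : cancelPair a ∈ cancelSubgroup R :=
  Subgroup.subset_closure ⟨a, rfl⟩

theorem cancelSubgroup_le_piTilde : cancelSubgroup R ≤ PiTilde R :=
  (Subgroup.closure_le _).2 (Set.range_subset_iff.2 cancelPair_mem_piTilde)

instance : (cancelSubgroup R).Normal where
  conj_mem x hx g := by
    rwa [← piTilde_central (cancelSubgroup_le_piTilde hx), mul_inv_cancel_right]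

theorem smul_mem_cancelSubgroup (w : FreeGroup X) {g : GUpsilon R} (hg : g ∈ cancelSubgroup R) :
    w • g ∈ cancelSubgroup R := by
  have hle : cancelSubgroup R ≤ (cancelSubgroup R).comap (actHom w) :=
    (Subgroup.closure_le _).2 <| Set.range_subset_iff.2 fun a => by
      change w • cancelPair a ∈ cancelSubgroup R
      rw [smul_cancelPair]
      exact cancelPair_mem_cancelSubgroup _
  exact hle hg

theorem mk_smul_cancelSubgroup_congr (w : FreeGroup X) {g h : GUpsilon R}
    (hgh : (QuotientGroup.mk g : GUpsilon R ⧸ cancelSubgroup R) = QuotientGroup.mk h) :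
    (QuotientGroup.mk (w • g) : GUpsilon R ⧸ cancelSubgroup R) = QuotientGroup.mk (w • h) := by
  rw [QuotientGroup.eq] at hgh ⊢
  rw [← smul_inv', ← smul_mul']
  exact smul_mem_cancelSubgroup w hgh

/-! ### The group of Peiffer classes -/

/-- The image `μσ(d)` of a `Y`-sequence in `𝒢(Υ)`. -/
def seqImage (R : Set (FreeGroup X)) : YSeq R →* GUpsilon R := (mu R).comp (sigma R)

theorem thetaTilde_seqImage (d : YSeq R) : thetaTilde (seqImage R d) = YSeq.theta d := by
  have : (thetaTilde (R := R)).comp (seqImage R) = YSeq.theta :=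
    FreeMonoid.hom_eq fun a => thetaTilde_gen a
  exact DFunLike.congr_fun this d

theorem isIdentity_iff_seqImage_mem {d : YSeq R} : d.IsIdentity ↔ seqImage R d ∈ PiTilde R := by
  rw [PiTilde, MonoidHom.mem_ker, thetaTilde_seqImage, YSeq.IsIdentity]

theorem seqImage_act (w : FreeGroup X) (d : YSeq R) :
    seqImage R (YSeq.act w d) = w • seqImage R d := by
  have : (seqImage R).comp (YSeq.act w) = (actHom w).comp (seqImage R) :=
    FreeMonoid.hom_eq fun a => (smul_gen w a).symm
  exact DFunLike.congr_fun this d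

/-- The class of a `Y`-sequence in the group `𝒢(Υ) ⧸ 𝔄̂`, a complete invariant of Peiffer
equivalence by `peifferEquiv_iff`. -/
def peifferClass (R : Set (FreeGroup X)) : YSeq R →* GUpsilon R ⧸ cancelSubgroup R :=
  (QuotientGroup.mk' _).comp (seqImage R)

theorem peifferClass_inv (d : YSeq R) :
    peifferClass R (YSeq.inv d) = (peifferClass R d)⁻¹ := by
  induction d using FreeMonoid.inductionOn' with
  | one => exact (map_one _).trans (by rw [map_one, inv_one])
  | of_mul a d ih =>
    have hinv : YSeq.inv (FreeMonoid.of a * d) = YSeq.inv d * FreeMonoid.of a.inv := by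
      simp only [YSeq.inv, map_mul, FreeMonoid.reverse_mul, FreeMonoid.map_of]
      rfl
    have hcancel : peifferClass R (FreeMonoid.of a) * peifferClass R (FreeMonoid.of a.inv) = 1 :=
      (QuotientGroup.eq_one_iff _).2 (cancelPair_mem_cancelSubgroup a)
    rw [hinv, map_mul, ih, map_mul, mul_inv_rev, inv_eq_of_mul_eq_one_right hcancel]

theorem peifferClass_surjective : Function.Surjective (peifferClass R) := by
  refine QuotientGroup.mk_surjective.forall.2 fun g => ?_
  have hg : g ∈ Subgroup.closure (Set.range (gen (R := R))) :=
    (PresentedGroup.closure_range_of (envelopingRels (upsilonRels R))).ge trivial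
  induction hg using Subgroup.closure_induction with
  | mem x hx =>
    obtain ⟨a, rfl⟩ := hx
    exact ⟨FreeMonoid.of a, rfl⟩
  | one => exact ⟨1, map_one _⟩
  | mul x y _ _ hx hy =>
    obtain ⟨d, hd⟩ := hx
    obtain ⟨e, he⟩ := hy
    exact ⟨d * e, by rw [map_mul, hd, he]; rfl⟩
  | inv x _ hx =>
    obtain ⟨d, hd⟩ := hx
    exact ⟨YSeq.inv d, by rw [peifferClass_inv, hd]; rfl⟩

theorem exists_isIdentity_peifferClass_eq {g : GUpsilon R} (hg : g ∈ PiTilde R) :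
    ∃ d : YSeq R, d.IsIdentity ∧ peifferClass R d = QuotientGroup.mk g := by
  obtain ⟨d, hd⟩ := peifferClass_surjective (QuotientGroup.mk g : GUpsilon R ⧸ cancelSubgroup R)
  have hdg : (seqImage R d)⁻¹ * g ∈ PiTilde R :=
    cancelSubgroup_le_piTilde (QuotientGroup.eq.1 hd)
  refine ⟨d, isIdentity_iff_seqImage_mem.2 ?_, hd⟩
  exact inv_mem_iff.1 ((Subgroup.mul_mem_cancel_right _ hg).1 hdg)

theorem PeifferStep.mul_mul {d e : YSeq R} (h : PeifferStep d e) (c c' : YSeq R) :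
    PeifferStep (c * d * c') (c * e * c') := by
  cases h with
  | exchangeLeft p q a b =>
    simpa only [mul_assoc] using PeifferStep.exchangeLeft (c * p) (q * c') a b
  | exchangeRight p q a b =>
    simpa only [mul_assoc] using PeifferStep.exchangeRight (c * p) (q * c') a b
  | deletion p q a => simpa only [mul_assoc] using PeifferStep.deletion (c * p) (q * c') a

theorem PeifferEquiv.mul_mul {d e : YSeq R} (h : PeifferEquiv d e) (c c' : YSeq R) :
    PeifferEquiv (c * d * c') (c * e * c') :=
  eqvGen_map (f := fun x => c * x * c') (fun _ _ hstep => .rel _ _ (hstep.mul_mul c c')) h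

/-- Peiffer equivalence as a congruence on the free monoid of `Y`-sequences. -/
def peifferCon (R : Set (FreeGroup X)) : Con (YSeq R) where
  r := PeifferEquiv
  iseqv := Relation.EqvGen.is_equivalence _
  mul' {d d' e e'} hd he := by
    have hleft : PeifferEquiv (d * e) (d' * e) := by simpa only [one_mul] using hd.mul_mul 1 e
    have hright : PeifferEquiv (d' * e) (d' * e') := by simpa only [mul_one] using he.mul_mul d' 1
    exact hleft.trans _ _ _ hright

/-- The class of a symbol modulo Peiffer equivalence, which the formal inverse makes a unit. -/
def symbolUnit (a : YSymbol R) : (peifferCon R).Quotientˣ where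
  val := (FreeMonoid.of a : YSeq R)
  inv := (FreeMonoid.of a.inv : YSeq R)
  val_inv := (Con.eq _).2 (.rel _ _ (by simpa using PeifferStep.deletion 1 1 a))
  inv_val := (Con.eq _).2 (.rel _ _ (by simpa using PeifferStep.deletion 1 1 a.inv))

/-- The homomorphism from `𝒢(Υ)` to the group of `Y`-sequences modulo Peiffer equivalence. -/
def toPeifferUnits (R : Set (FreeGroup X)) : GUpsilon R →* (peifferCon R).Quotientˣ :=
  gUpsilonLift symbolUnit fun a b => Units.ext <|
    (Con.eq (peifferCon R)).2 (.rel _ _ (by simpa using PeifferStep.exchangeLeft 1 1 a b))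

theorem toPeifferUnits_gen (a : YSymbol R) : toPeifferUnits R (gen a) = symbolUnit a :=
  gUpsilonLift_gen _ _ a

theorem toPeifferUnits_seqImage (d : YSeq R) :
    (toPeifferUnits R (seqImage R d) : (peifferCon R).Quotient) = d := by
  have : (Units.coeHom _).comp ((toPeifferUnits R).comp (seqImage R)) = (peifferCon R).mk' :=
    FreeMonoid.hom_eq fun a => congrArg Units.val (toPeifferUnits_gen a)
  exact DFunLike.congr_fun this d

theorem cancelSubgroup_le_ker_toPeifferUnits : cancelSubgroup R ≤ (toPeifferUnits R).ker := by
  refine (Subgroup.closure_le _).2 (Set.range_subset_iff.2 fun a => Units.ext ?_)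
  exact (toPeifferUnits_seqImage (FreeMonoid.of a * FreeMonoid.of a.inv)).trans
    (symbolUnit a).val_inv

theorem peifferEquiv_of_peifferClass_eq {d e : YSeq R} (h : peifferClass R d = peifferClass R e) :
    PeifferEquiv d e := by
  have hker := cancelSubgroup_le_ker_toPeifferUnits (QuotientGroup.eq.1 h)
  rw [MonoidHom.mem_ker, map_mul, map_inv, inv_mul_eq_one] at hker
  have hunits := congrArg Units.val hker
  rw [toPeifferUnits_seqImage, toPeifferUnits_seqImage] at hunits
  exact (Con.eq (peifferCon R)).1 hunits

theorem commute_sigma_of_mul_inv (a : YSymbol R) (q : YSeq R) :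
    Commute (sigma R (FreeMonoid.of a * FreeMonoid.of a.inv)) (sigma R q) := by
  induction q using FreeMonoid.inductionOn' with
  | one => rw [map_one]; exact Commute.one_right _
  | of_mul b q ih =>
    have hb : Commute (sigma R (FreeMonoid.of a * FreeMonoid.of a.inv))
        (sigma R (FreeMonoid.of b)) := by
      have hinv := of_mul_of a.inv b
      have hself := of_mul_of a (a.inv.theta • b)
      rw [YSymbol.theta_inv] at hinv hself
      rw [smul_inv_smul] at hself
      change PresentedMonoid.of _ a * PresentedMonoid.of _ a.inv * PresentedMonoid.of _ b
        = PresentedMonoid.of _ b * (PresentedMonoid.of _ a * PresentedMonoid.of _ a.inv)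
      rw [mul_assoc, hinv, ← mul_assoc, hself, mul_assoc]
    rw [map_mul _ _ q]
    exact hb.mul_right ih

theorem PeifferStep.upsilonPeifferEquiv {d e : YSeq R} (h : PeifferStep d e) :
    UpsilonPeifferEquiv (sigma R d) (sigma R e) := by
  cases h with
  | exchangeLeft p q a b =>
    have hab : sigma R (FreeMonoid.of a * FreeMonoid.of b)
        = sigma R (FreeMonoid.of (a.theta • b) * FreeMonoid.of a) := of_mul_of a b
    rw [map_mul, map_mul _ p, hab, ← map_mul, ← map_mul]
    exact .refl _
  | exchangeRight p q a b =>
    have hba : sigma R (FreeMonoid.of b * FreeMonoid.of (b.theta⁻¹ • a))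
        = sigma R (FreeMonoid.of a * FreeMonoid.of b) := by
      have := of_mul_of b (b.theta⁻¹ • a)
      rwa [smul_inv_smul] at this
    rw [map_mul, map_mul _ p, ← hba, ← map_mul, ← map_mul]
    exact .refl _
  | deletion p q a =>
    refine .symm _ _ (.rel _ _ ⟨p * q, a, rfl, ?_⟩)
    have hcomm := (commute_sigma_of_mul_inv a q).eq
    simp only [map_mul] at hcomm ⊢
    rw [mul_assoc, hcomm, mul_assoc]

theorem PeifferEquiv.upsilonPeifferEquiv {d e : YSeq R} (h : PeifferEquiv d e) :
    UpsilonPeifferEquiv (sigma R d) (sigma R e) :=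
  eqvGen_map (fun _ _ hstep => hstep.upsilonPeifferEquiv) h

theorem peifferClass_eq_of_upsilonPeifferEquiv {d e : YSeq R}
    (h : UpsilonPeifferEquiv (sigma R d) (sigma R e)) : peifferClass R d = peifferClass R e := by
  let mkMu (s : Upsilon R) : GUpsilon R ⧸ cancelSubgroup R := QuotientGroup.mk (mu R s)
  refine (eq_equivalence.comap mkMu).eqvGen_iff.1 (Relation.EqvGen.mono ?_ _ _ h)
  rintro _ _ ⟨p, a, rfl, rfl⟩
  refine QuotientGroup.eq.2 ?_
  rw [map_mul, inv_mul_cancel_left, map_mul]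
  exact cancelPair_mem_cancelSubgroup a

theorem peifferEquiv_iff {d e : YSeq R} : PeifferEquiv d e ↔ peifferClass R d = peifferClass R e :=
  ⟨fun h => peifferClass_eq_of_upsilonPeifferEquiv h.upsilonPeifferEquiv,
    peifferEquiv_of_peifferClass_eq⟩

theorem upsilonPeifferEquiv_iff {d e : YSeq R} :
    UpsilonPeifferEquiv (sigma R d) (sigma R e) ↔ peifferClass R d = peifferClass R e :=
  ⟨peifferClass_eq_of_upsilonPeifferEquiv,
    fun h => (peifferEquiv_of_peifferClass_eq h).upsilonPeifferEquiv⟩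

theorem isAspherical_iff_piTilde_le : IsAspherical R ↔ PiTilde R ≤ cancelSubgroup R := by
  simp only [IsAspherical, peifferEquiv_iff, map_one]
  constructor
  · intro h g hg
    obtain ⟨d, hd, hdg⟩ := exists_isIdentity_peifferClass_eq hg
    rw [← QuotientGroup.eq_one_iff, ← hdg, h d hd]
  · intro h d hd
    exact (QuotientGroup.eq_one_iff _).2 (h (isIdentity_iff_seqImage_mem.1 hd))

/-! ### The displacement subgroup -/

theorem displacement_le_subgroupOf_iff {N : Subgroup (FreeGroup X)} {H : Subgroup (GUpsilon R)} :
    displacement R N ≤ H.subgroupOf (PiTilde R) ↔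
      ∀ d ∈ PiTilde R, ∀ n ∈ N, n • d * d⁻¹ ∈ H := by
  rw [displacement, Subgroup.closure_le]
  constructor
  · intro h d hd n hn
    exact h (a := ⟨n • d * d⁻¹, mul_mem (smul_mem_piTilde n hd) (inv_mem hd)⟩) ⟨⟨d, hd⟩, n, hn, rfl⟩
  · rintro h x ⟨d, n, hn, hx⟩
    change (x : GUpsilon R) ∈ H
    rw [hx]
    exact h d d.2 n hn

theorem smul_mul_inv_mem_map_displacement {N : Subgroup (FreeGroup X)} {d : GUpsilon R}
    (hd : d ∈ PiTilde R) {n : FreeGroup X} (hn : n ∈ N) :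
    n • d * d⁻¹ ∈ (displacement R N).map (PiTilde R).subtype :=
  displacement_le_subgroupOf_iff.1 (Subgroup.le_comap_map _ _) d hd n hn

theorem upsilonPeifferEquiv_act_mul_inv_iff {d : YSeq R} {n : FreeGroup X} :
    UpsilonPeifferEquiv (sigma R (YSeq.act n d * YSeq.inv d)) 1 ↔
      n • seqImage R d * (seqImage R d)⁻¹ ∈ cancelSubgroup R := by
  rw [← map_one (sigma R), upsilonPeifferEquiv_iff, map_one, map_mul, peifferClass_inv,
    ← seqImage_act, ← QuotientGroup.eq_one_iff]
  rfl

theorem forall_upsilonPeifferEquiv_iff_displacement_le {N : Subgroup (FreeGroup X)} :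
    (∀ d : YSeq R, d.IsIdentity → ∀ n ∈ N,
      UpsilonPeifferEquiv (sigma R (YSeq.act n d * YSeq.inv d)) 1) ↔
      displacement R N ≤ (cancelSubgroup R).subgroupOf (PiTilde R) := by
  simp only [upsilonPeifferEquiv_act_mul_inv_iff, displacement_le_subgroupOf_iff]
  constructor
  · intro h g hg n hn
    obtain ⟨d, hd, hdg⟩ := exists_isIdentity_peifferClass_eq hg
    have hsmul := mk_smul_cancelSubgroup_congr n hdg
    rw [← QuotientGroup.eq_one_iff, QuotientGroup.mk_mul, QuotientGroup.mk_inv, ← hsmul, ← hdg]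
    exact (QuotientGroup.eq_one_iff _).2 (h d hd n hn)
  · intro h d hd n hn
    exact h _ (isIdentity_iff_seqImage_mem.1 hd) n hn

/-! ### The retraction onto the cancelling pairs -/

/-- The retraction `ρ` of `𝒢(Υ)` onto `𝔄̂` that maps a positive symbol `a` to `a a⁻¹` and a negative
one to `1`. -/
def cancelRetraction (R : Set (FreeGroup X)) : GUpsilon R →* cancelSubgroup R :=
  gUpsilonLift
    (fun a => if a.sign = 1 then ⟨cancelPair a, cancelPair_mem_cancelSubgroup a⟩ else 1)
    fun a b => by
      have hsign : (a.theta • b).sign = b.sign := rfl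
      simp only [hsign, cancelPair_theta_smul]
      exact Subtype.ext (piTilde_central (cancelSubgroup_le_piTilde (Subtype.prop _)) _)

theorem coe_cancelRetraction_gen (a : YSymbol R) :
    (cancelRetraction R (gen a) : GUpsilon R) = if a.sign = 1 then cancelPair a else 1 := by
  rw [cancelRetraction, gUpsilonLift_gen]
  split_ifs <;> rfl

theorem coe_cancelRetraction_cancelPair (a : YSymbol R) :
    (cancelRetraction R (cancelPair a) : GUpsilon R) = cancelPair a := by
  rw [cancelPair, map_mul, Subgroup.coe_mul, coe_cancelRetraction_gen, coe_cancelRetraction_gen,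
    cancelPair_inv]
  rcases Int.units_eq_one_or a.sign with h | h <;> simp [h, YSymbol.inv, cancelPair]

theorem coe_cancelRetraction_of_mem {g : GUpsilon R} (hg : g ∈ cancelSubgroup R) :
    (cancelRetraction R g : GUpsilon R) = g :=
  MonoidHom.eqOn_closure (f := (cancelSubgroup R).subtype.comp (cancelRetraction R))
    (g := MonoidHom.id _) (Set.forall_mem_range.2 coe_cancelRetraction_cancelPair) hg

theorem coe_cancelRetraction_smul (w : FreeGroup X) (g : GUpsilon R) :
    (cancelRetraction R (w • g) : GUpsilon R) = w • (cancelRetraction R g : GUpsilon R) := by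
  have : (cancelSubgroup R).subtype.comp ((cancelRetraction R).comp (actHom w))
      = (actHom w).comp ((cancelSubgroup R).subtype.comp (cancelRetraction R)) :=
    gUpsilon_hom_ext fun a => by
      change (cancelRetraction R (w • gen a) : GUpsilon R)
        = w • (cancelRetraction R (gen a) : GUpsilon R)
      have hsign : (w • a).sign = a.sign := rfl
      rw [smul_gen, coe_cancelRetraction_gen, coe_cancelRetraction_gen, hsign, smul_ite,
        smul_cancelPair, smul_one]
  exact DFunLike.congr_fun this g

theorem cancelRetraction_mem_map_displacement {N : Subgroup (FreeGroup X)} {g : GUpsilon R}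
    (hg : g ∈ smulCommutator (GUpsilon R) N) :
    (cancelRetraction R g : GUpsilon R) ∈ (displacement R N).map (PiTilde R).subtype := by
  have hnormal : ((displacement R N).map (PiTilde R).subtype).Normal := ⟨by
    rintro _ ⟨d, hd, rfl⟩ x
    rw [Subgroup.subtype_apply, ← piTilde_central d.2 x, mul_inv_cancel_right]
    exact Subgroup.mem_map_of_mem _ hd⟩
  have hle : smulCommutator (GUpsilon R) N ≤ ((displacement R N).map (PiTilde R).subtype).comap
      ((cancelSubgroup R).subtype.comp (cancelRetraction R)) := by
    refine Subgroup.normalClosure_le_normal ?_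
    rintro _ ⟨x, n, hn, rfl⟩
    change (cancelRetraction R (n • x * x⁻¹) : GUpsilon R)
      ∈ (displacement R N).map (PiTilde R).subtype
    rw [map_mul, map_inv, Subgroup.coe_mul, Subgroup.coe_inv, coe_cancelRetraction_smul]
    exact smul_mul_inv_mem_map_displacement (cancelSubgroup_le_piTilde (Subtype.prop _)) hn
  exact hle hg

/-! ### Subpresentations -/

section Subpresentation

variable (h : R ⊆ S)

theorem fHat_gen (a : YSymbol R) : fHat h (gen a) = gen (a.incl h) := gUpsilonLift_gen _ _ a

theorem fHat_cancelPair (a : YSymbol R) : fHat h (cancelPair a) = cancelPair (a.incl h) := by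
  rw [cancelPair, map_mul, fHat_gen, fHat_gen]
  rfl

theorem fHat_smul (w : FreeGroup X) (g : GUpsilon R) : fHat h (w • g) = w • fHat h g := by
  have : (fHat h).comp (actHom w) = (actHom w).comp (fHat h) :=
    gUpsilon_hom_ext fun a => by
      change fHat h (w • gen a) = w • fHat h (gen a)
      rw [smul_gen, fHat_gen, fHat_gen, smul_gen]
      rfl
  exact DFunLike.congr_fun this g

theorem thetaTilde_fHat (g : GUpsilon R) : thetaTilde (fHat h g) = thetaTilde g := by
  have : thetaTilde.comp (fHat h) = thetaTilde :=
    gUpsilon_hom_ext fun a => by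
      rw [MonoidHom.comp_apply, fHat_gen, thetaTilde_gen, thetaTilde_gen]
      rfl
  exact DFunLike.congr_fun this g

theorem fHat_mem_piTilde {d : GUpsilon R} (hd : d ∈ PiTilde R) : fHat h d ∈ PiTilde S :=
  (thetaTilde_fHat h d).trans hd

theorem coe_cancelRetraction_fHat (g : GUpsilon R) :
    (cancelRetraction S (fHat h g) : GUpsilon S) = fHat h (cancelRetraction R g) := by
  have : (cancelSubgroup S).subtype.comp ((cancelRetraction S).comp (fHat h))
      = (fHat h).comp ((cancelSubgroup R).subtype.comp (cancelRetraction R)) :=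
    gUpsilon_hom_ext fun a => by
      change (cancelRetraction S (fHat h (gen a)) : GUpsilon S)
        = fHat h (cancelRetraction R (gen a) : GUpsilon R)
      have hsign : (a.incl h).sign = a.sign := rfl
      rw [fHat_gen, coe_cancelRetraction_gen, coe_cancelRetraction_gen, hsign, apply_ite (fHat h),
        fHat_cancelPair, map_one]
  exact DFunLike.congr_fun this g

theorem aHat_eq_map_cancelSubgroup : AHat h = (cancelSubgroup R).map (fHat h) := by
  rw [cancelSubgroup, MonoidHom.map_closure, ← Set.range_comp, AHat]
  congr 1
  ext x
  exact exists_congr fun b => by rw [Function.comp_apply, fHat_cancelPair, eq_comm]; rfl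

theorem fHat_mem_aHat (hS : IsAspherical S) {d : GUpsilon R} (hd : d ∈ PiTilde R) :
    fHat h d ∈ AHat h := by
  have hcancel : fHat h d ∈ cancelSubgroup S :=
    isAspherical_iff_piTilde_le.1 hS (fHat_mem_piTilde h hd)
  rw [← coe_cancelRetraction_of_mem hcancel, coe_cancelRetraction_fHat, aHat_eq_map_cancelSubgroup]
  exact Subgroup.mem_map_of_mem _ (Subtype.prop _)

theorem displacement_le_ker_fHat {N : Subgroup (FreeGroup X)}
    (hN : N ≤ Subgroup.normalClosure S) :
    displacement R N ≤ (fHat h).ker.subgroupOf (PiTilde R) :=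
  displacement_le_subgroupOf_iff.2 fun d hd n hn => by
    rw [MonoidHom.mem_ker, map_mul, map_inv, fHat_smul,
      smul_eq_self_of_mem_normalClosure (hN hn) (fHat_mem_piTilde h hd), mul_inv_cancel]

open Classical in
/-- The homomorphism from `𝒢(Υ)` to `𝒢(Υ₁)` modulo the elements `ⁿg g⁻¹` that fixes the symbols of
`Y₁ ∪ Y₁⁻¹` and sends the other ones to `1`. -/
noncomputable def killRemoved {N : Subgroup (FreeGroup X)} [N.Normal] (hN : S \ R ⊆ N) :
    GUpsilon S →* GUpsilon R ⧸ smulCommutator (GUpsilon R) N :=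
  gUpsilonLift
    (fun a => if ha : (a.rel : FreeGroup X) ∈ R then
      QuotientGroup.mk (gen ⟨a.conj, ⟨a.rel, ha⟩, a.sign⟩) else 1)
    fun a b => by
      have hrel : (a.theta • b).rel = b.rel := rfl
      by_cases hb : (b.rel : FreeGroup X) ∈ R
      · let b₁ : YSymbol R := ⟨b.conj, ⟨b.rel, hb⟩, b.sign⟩
        by_cases ha : (a.rel : FreeGroup X) ∈ R
        · let a₁ : YSymbol R := ⟨a.conj, ⟨a.rel, ha⟩, a.sign⟩
          simp only [hrel, ha, hb, dite_true]
          exact congrArg QuotientGroup.mk (gen_mul_gen a₁ b₁)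
        · have hmem : a.theta ∈ N := YSymbol.theta_mem (hN ⟨a.rel.2, ha⟩)
          simp only [hrel, ha, hb, dite_true, dite_false, one_mul, mul_one]
          have hsmul := mk_smul_smulCommutator hmem (gen b₁)
          rw [smul_gen] at hsmul
          exact hsmul.symm
      · simp only [hrel, hb, dite_false, one_mul, mul_one]

theorem killRemoved_fHat {N : Subgroup (FreeGroup X)} [N.Normal] (hN : S \ R ⊆ N)
    (g : GUpsilon R) : killRemoved hN (fHat h g) = QuotientGroup.mk g := by
  have : (killRemoved hN).comp (fHat h) = QuotientGroup.mk' _ :=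
    gUpsilon_hom_ext fun a => by
      rw [MonoidHom.comp_apply, fHat_gen, killRemoved, gUpsilonLift_gen]
      exact dif_pos a.rel.2
  exact DFunLike.congr_fun this g

theorem ker_fHat_le_smulCommutator {N : Subgroup (FreeGroup X)} [N.Normal] (hN : S \ R ⊆ N) :
    (fHat h).ker ≤ smulCommutator (GUpsilon R) N := fun g hg => by
  rw [← QuotientGroup.eq_one_iff, ← killRemoved_fHat h hN, MonoidHom.mem_ker.1 hg, map_one]

theorem mem_map_displacement_of_fHat_eq_one {N : Subgroup (FreeGroup X)} [N.Normal]
    (hN : S \ R ⊆ N) {g : GUpsilon R} (hg : g ∈ cancelSubgroup R) (hker : fHat h g = 1) :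
    g ∈ (displacement R N).map (PiTilde R).subtype := by
  rw [← coe_cancelRetraction_of_mem hg]
  exact cancelRetraction_mem_map_displacement (ker_fHat_le_smulCommutator h hN hker)

/-- The homomorphism `φ̂ : Π̃₁ ⧸ [Π̃₁, N] → 𝔄̂₁` induced by `f̂`. -/
def phiHat (hS : IsAspherical S) {N : Subgroup (FreeGroup X)}
    (hN : N ≤ Subgroup.normalClosure S) : (PiTilde R ⧸ displacement R N) →* AHat h :=
  QuotientGroup.lift _
    (((fHat h).comp (PiTilde R).subtype).codRestrict (AHat h) fun d => fHat_mem_aHat h hS d.2)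
    fun _ hd => Subtype.ext (displacement_le_ker_fHat h hN hd)

variable (hS : IsAspherical S) {N : Subgroup (FreeGroup X)} (hN : N ≤ Subgroup.normalClosure S)

theorem coe_phiHat_mk (d : PiTilde R) :
    (phiHat h hS hN (QuotientGroup.mk d) : GUpsilon S) = fHat h (d : GUpsilon R) := rfl

theorem phiHat_surjective : Function.Surjective (phiHat h hS hN) := by
  rintro ⟨x, hx⟩
  rw [aHat_eq_map_cancelSubgroup] at hx
  obtain ⟨d, hd, rfl⟩ := hx
  exact ⟨QuotientGroup.mk ⟨d, cancelSubgroup_le_piTilde hd⟩, rfl⟩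

theorem phiHat_injective [N.Normal] (hRN : S \ R ⊆ N) (hR : IsAspherical R) :
    Function.Injective (phiHat h hS hN) := by
  refine (injective_iff_map_eq_one _).2 (QuotientGroup.mk_surjective.forall.2 ?_)
  rintro ⟨d, hd⟩ hker
  obtain ⟨e, he, rfl⟩ := mem_map_displacement_of_fHat_eq_one h hRN
    (isAspherical_iff_piTilde_le.1 hR hd) (congrArg Subtype.val hker)
  exact (QuotientGroup.eq_one_iff _).2 he

theorem isAspherical_of_phiHat_injective
    (hdisp : displacement R N ≤ (cancelSubgroup R).subgroupOf (PiTilde R))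
    (hinj : Function.Injective (phiHat h hS hN)) : IsAspherical R := by
  refine isAspherical_iff_piTilde_le.2 fun d hd => ?_
  have himage : fHat h d ∈ AHat h := fHat_mem_aHat h hS hd
  rw [aHat_eq_map_cancelSubgroup] at himage
  obtain ⟨c, hc, hcd⟩ := himage
  have hclass : (QuotientGroup.mk ⟨c, cancelSubgroup_le_piTilde hc⟩ : PiTilde R ⧸ displacement R N)
      = QuotientGroup.mk ⟨d, hd⟩ := hinj (Subtype.ext hcd)
  have hquot : c⁻¹ * d ∈ cancelSubgroup R := hdisp (QuotientGroup.eq.1 hclass)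
  exact (Subgroup.mul_mem_cancel_left _ (inv_mem hc)).1 hquot

end Subpresentation

end Peiffer

theorem mainTheorem2_general {X : Type*} (R T : Set (FreeGroup X)) (hT : T ⊆ R)
    (hR : IsAspherical R) :
    ∃ φ : (PiTilde (R \ T) ⧸ displacement (R \ T) (Subgroup.normalClosure T)) →*
        AHat (Set.sdiff_subset : R \ T ⊆ R),
      (∀ d : PiTilde (R \ T),
        (φ (QuotientGroup.mk d) : GUpsilon R) = fHat Set.sdiff_subset (d : GUpsilon (R \ T))) ∧
      (IsAspherical (R \ T) ↔
        (∀ d : YSeq (R \ T), d.IsIdentity → ∀ n ∈ Subgroup.normalClosure T,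
          UpsilonPeifferEquiv (sigma (R \ T) (YSeq.act n d * YSeq.inv d)) 1) ∧
        Function.Bijective φ) := by
  have hN : Subgroup.normalClosure T ≤ Subgroup.normalClosure R := Subgroup.normalClosure_mono hT
  have hremoved : R \ (R \ T) ⊆ Subgroup.normalClosure T := by
    rw [Set.sdiff_sdiff_cancel_left hT]
    exact Subgroup.subset_normalClosure
  refine ⟨phiHat Set.sdiff_subset hR hN, coe_phiHat_mk Set.sdiff_subset hR hN, ?_⟩
  rw [forall_upsilonPeifferEquiv_iff_displacement_le]
  constructor
  · intro h
    have hle : PiTilde (R \ T) ≤ cancelSubgroup (R \ T) := isAspherical_iff_piTilde_le.1 h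
    exact ⟨fun d _ => hle d.2, phiHat_injective _ hR hN hremoved h, phiHat_surjective _ hR hN⟩
  · rintro ⟨hdisp, hinj, -⟩
    exact isAspherical_of_phiHat_injective _ hR hN hdisp hinj

theorem mainTheorem2 {X : Type*} (R : Set (FreeGroup X)) (r₀ : FreeGroup X) (hr₀ : r₀ ∈ R)
    (hR : IsAspherical R) :
    ∃ φ : (PiTilde (R \ {r₀}) ⧸ displacement (R \ {r₀}) (Subgroup.normalClosure {r₀})) →*
        AHat (Set.sdiff_subset : R \ {r₀} ⊆ R),
      (∀ d : PiTilde (R \ {r₀}),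
        (φ (QuotientGroup.mk d) : GUpsilon R) = fHat Set.sdiff_subset (d : GUpsilon (R \ {r₀}))) ∧
      (IsAspherical (R \ {r₀}) ↔
        (∀ d : YSeq (R \ {r₀}), d.IsIdentity → ∀ n ∈ Subgroup.normalClosure {r₀},
          UpsilonPeifferEquiv (sigma (R \ {r₀}) (YSeq.act n d * YSeq.inv d)) 1) ∧
        Function.Bijective φ) :=
  mainTheorem2_general R {r₀} (Set.singleton_subset_iff.2 hr₀) hR
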